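/- Let $K$ be a field and let $\Gamma$ be a quiver with at least one vertex. Let $K\Gamma$ be the path coalgebra of $\Gamma$: the $K$-vector space with basis the set of all paths in $\Gamma$ (the vertices being the paths of length zero), with comultiplication $\Delta(p)=\sum_{qr=p}q\otimes r$ for every path $p$, where $qr$ denotes the arrows of $q$ followed by the arrows of $r$, and with counit $\varepsilon(v)=1$ for every vertex $v$ and $\varepsilon(p)=0$ for every path $p$ of positive length. Assume that $K\Gamma$ is finite dimensional. Then $K\Gamma$ has a Hopf algebra structure (that is, the coalgebra $K\Gamma$ is the underlying coalgebra of a Hopf algebra over $K$) if and only if $K\Gamma$ is cosemisimple (a direct sum of simple subcoalgebras), and $K\Gamma$ is cosemisimple if and only if $\Gamma$ has no arrows. -/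

import Mathlib

open scoped TensorProduct

/-- `Splitting a b` is the type of triples `(c, q, r)` where `q` is a path from `a` to `c` and `r` is
a path from `c` to `b`. -/
abbrev Splitting {V : Type*} [Quiver V] (a b : V) : Type _ :=
  Σ c : V, Quiver.Path a c × Quiver.Path c b

/-- The list of all pairs of paths `(q, r)` with `q r = p`. -/
def splittings {V : Type*} [Quiver V] {a : V} :
    ∀ {b : V}, Quiver.Path a b → List (Splitting a b)
  | _, .nil => [⟨a, .nil, .nil⟩]
  | _, .cons p e =>
      (splittings p).map (fun s => ⟨s.1, s.2.1, s.2.2.cons e⟩) ++ [⟨_, p.cons e, .nil⟩]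

/-- `splittings p` contains exactly the pairs `(q, r)` with `q r = p`. -/
theorem mem_splittings_iff {V : Type*} [Quiver V] {a b : V} (p : Quiver.Path a b)
    (s : Splitting a b) : s ∈ splittings p ↔ s.2.1.comp s.2.2 = p := by
  induction p with
  | nil =>
    obtain ⟨c, q, r⟩ := s
    simp only [splittings, List.mem_singleton]
    constructor
    · rintro h
      cases h
      rfl
    · intro h
      cases r with
      | nil => cases h; rfl
      | cons r e => cases h
  | cons p e ih =>
    obtain ⟨c, q, r⟩ := s
    simp only [splittings, List.mem_append, List.mem_map, List.mem_singleton]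
    constructor
    · rintro (⟨t, ht, h⟩ | h)
      · cases h
        simp [(ih t).1 ht]
      · cases h
        rfl
    · intro h
      cases r with
      | nil =>
        right
        cases h
        rfl
      | cons r e' =>
        left
        cases h
        exact ⟨⟨c, q, r⟩, (ih _).2 rfl, rfl⟩

/-- `splittings p` contains every pair `(q, r)` with `q r = p` only once. -/
theorem nodup_splittings {V : Type*} [Quiver V] {a b : V} (p : Quiver.Path a b) :
    (splittings p).Nodup := by
  induction p with
  | nil => simp [splittings]
  | cons p e ih =>
    simp only [splittings]
    refine List.nodup_append.2 ⟨ih.map ?_, List.nodup_singleton _, ?_⟩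
    · rintro ⟨c, q, r⟩ ⟨c', q', r'⟩ h
      cases h
      rfl
    · intro x hx y hy hxy
      obtain ⟨⟨c, q, r⟩, -, rfl⟩ := List.mem_map.1 hx
      rw [List.mem_singleton.1 hy] at hxy
      have hl := congrArg (fun s : Splitting _ _ => s.2.2.length) hxy
      simp at hl

theorem sum_splittings_assoc {V : Type*} [Quiver V] {M : Type*} [AddCommMonoid M] {a b : V}
    (p : Quiver.Path a b)
    (f : ∀ c d : V, Quiver.Path a c → Quiver.Path c d → Quiver.Path d b → M) :
    ((splittings p).map fun s =>
      ((splittings s.2.1).map fun t => f t.1 s.1 t.2.1 t.2.2 s.2.2).sum).sum =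
    ((splittings p).map fun s =>
      ((splittings s.2.2).map fun t => f s.1 t.1 s.2.1 t.2.1 t.2.2).sum).sum := by
  induction p with
  | nil => simp [splittings]
  | cons p e ih =>
    have h := ih (fun c d q r t => f c d q r (t.cons e))
    simp only [splittings, List.map_append, List.sum_append, List.map_map, Function.comp_def,
      List.map_cons, List.map_nil, List.sum_cons, List.sum_nil, add_zero, List.sum_map_add] at h ⊢
    rw [h, add_assoc]

/-- The type of all paths of the quiver `V`, the vertices being the paths of length zero. -/
abbrev AllPaths (V : Type*) [Quiver V] : Type _ := Σ a b : V, Quiver.Path a b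

/-- The vector space underlying the path coalgebra `KΓ` of the quiver `Γ` with vertex type `V`:
it has the paths of `Γ` as a basis. (A separate name, because Mathlib puts another
coalgebra structure on `AllPaths V →₀ K`.) -/
def PathCoalgebra (K : Type*) [Field K] (V : Type*) [Quiver V] : Type _ := AllPaths V →₀ K

namespace PathCoalgebra

noncomputable instance (K : Type*) [Field K] (V : Type*) [Quiver V] :
    AddCommGroup (PathCoalgebra K V) :=
  inferInstanceAs (AddCommGroup (AllPaths V →₀ K))

noncomputable instance (K : Type*) [Field K] (V : Type*) [Quiver V] :
    Module K (PathCoalgebra K V) :=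
  inferInstanceAs (Module K (AllPaths V →₀ K))

/-- The basis of `KΓ` consisting of all paths. -/
noncomputable def pathBasis (K : Type*) [Field K] (V : Type*) [Quiver V] :
    Module.Basis (AllPaths V) K (PathCoalgebra K V) :=
  .ofRepr (LinearEquiv.refl K (AllPaths V →₀ K))

/-- A path, viewed as an element of `KΓ`. -/
noncomputable def ofPath (K : Type*) [Field K] {V : Type*} [Quiver V] {a b : V}
    (p : Quiver.Path a b) : PathCoalgebra K V :=
  pathBasis K V ⟨a, b, p⟩

/-- `Δ(p) = ∑_{q r = p} q ⊗ r`; `ε(v) = 1` for a vertex `v`, and `ε(p) = 0` for a path `p` of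
positive length. -/
noncomputable instance instCoalgebraStruct (K : Type*) [Field K] (V : Type*) [Quiver V] :
    CoalgebraStruct K (PathCoalgebra K V) where
  comul := (pathBasis K V).constr K fun p =>
    ((splittings p.2.2).map fun s => ofPath K s.2.1 ⊗ₜ[K] ofPath K s.2.2).sum
  counit := (pathBasis K V).constr K fun p => if p.2.2.length = 0 then 1 else 0

theorem comul_ofPath (K : Type*) [Field K] {V : Type*} [Quiver V] {a b : V}
    (p : Quiver.Path a b) :
    CoalgebraStruct.comul (R := K) (ofPath K p) =
      ((splittings p).map fun s => ofPath K s.2.1 ⊗ₜ[K] ofPath K s.2.2).sum :=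
  (pathBasis K V).constr_basis K _ _

theorem counit_ofPath (K : Type*) [Field K] {V : Type*} [Quiver V] {a b : V}
    (p : Quiver.Path a b) :
    CoalgebraStruct.counit (R := K) (ofPath K p) = if p.length = 0 then (1 : K) else 0 :=
  (pathBasis K V).constr_basis K _ _

theorem sum_splittings_counit_left (K : Type*) [Field K] {V : Type*} [Quiver V] {M : Type*}
    [AddCommMonoid M] [Module K M] {a b : V} (p : Quiver.Path a b)
    (g : ∀ c : V, Quiver.Path c b → M) :
    ((splittings p).map fun s =>
      (if s.2.1.length = 0 then (1 : K) else 0) • g s.1 s.2.2).sum = g a p := by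
  induction p with
  | nil => simp [splittings]
  | cons p e ih =>
    simpa [splittings, Function.comp_def] using ih fun c q => g c (q.cons e)

theorem sum_splittings_counit_right (K : Type*) [Field K] {V : Type*} [Quiver V] {M : Type*}
    [AddCommMonoid M] [Module K M] {a b : V} (p : Quiver.Path a b)
    (g : ∀ c : V, Quiver.Path a c → M) :
    ((splittings p).map fun s =>
      (if s.2.2.length = 0 then (1 : K) else 0) • g s.1 s.2.1).sum = g b p := by
  cases p with
  | nil => simp [splittings]
  | cons p e => simp [splittings, Function.comp_def]

/-- The path coalgebra `KΓ`. -/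
noncomputable instance instCoalgebra (K : Type*) [Field K] (V : Type*) [Quiver V] :
    Coalgebra K (PathCoalgebra K V) where
  coassoc := by
    refine (pathBasis K V).ext ?_
    rintro ⟨a, b, p⟩
    change TensorProduct.assoc K _ _ _ (LinearMap.rTensor _ _
      (CoalgebraStruct.comul (R := K) (ofPath K p))) =
      LinearMap.lTensor _ _ (CoalgebraStruct.comul (R := K) (ofPath K p))
    have hl : ∀ {c d : V} (q : Quiver.Path c d) (x : PathCoalgebra K V),
        TensorProduct.assoc K _ _ _
          (CoalgebraStruct.comul (R := K) (ofPath K q) ⊗ₜ[K] x) =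
        ((splittings q).map fun t => ofPath K t.2.1 ⊗ₜ[K] (ofPath K t.2.2 ⊗ₜ[K] x)).sum := by
      intro c d q x
      rw [comul_ofPath]
      induction splittings q with
      | nil => simp
      | cons s l ih => simp [TensorProduct.add_tmul, ih]
    have hr : ∀ {c d : V} (q : Quiver.Path c d) (x : PathCoalgebra K V),
        x ⊗ₜ[K] CoalgebraStruct.comul (R := K) (ofPath K q) =
        ((splittings q).map fun t => x ⊗ₜ[K] (ofPath K t.2.1 ⊗ₜ[K] ofPath K t.2.2)).sum := by
      intro c d q x
      rw [comul_ofPath]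
      induction splittings q with
      | nil => simp
      | cons s l ih => simp [TensorProduct.tmul_add, ih]
    rw [comul_ofPath]
    simp only [map_list_sum, List.map_map, Function.comp_def, LinearMap.rTensor_tmul,
      LinearMap.lTensor_tmul, hl, hr]
    exact sum_splittings_assoc p
      fun c d q r t => ofPath K q ⊗ₜ[K] (ofPath K r ⊗ₜ[K] ofPath K t)
  rTensor_counit_comp_comul := by
    refine (pathBasis K V).ext ?_
    rintro ⟨a, b, p⟩
    change LinearMap.rTensor _ _ (CoalgebraStruct.comul (R := K) (ofPath K p)) =
      (1 : K) ⊗ₜ[K] ofPath K p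
    rw [comul_ofPath]
    simp only [map_list_sum, List.map_map, Function.comp_def, LinearMap.rTensor_tmul,
      counit_ofPath]
    rw [← sum_splittings_counit_left K p fun c q => (1 : K) ⊗ₜ[K] ofPath K q]
    simp only [TensorProduct.smul_tmul', smul_eq_mul, mul_one]
  lTensor_counit_comp_comul := by
    refine (pathBasis K V).ext ?_
    rintro ⟨a, b, p⟩
    change LinearMap.lTensor _ _ (CoalgebraStruct.comul (R := K) (ofPath K p)) =
      ofPath K p ⊗ₜ[K] (1 : K)
    rw [comul_ofPath]
    simp only [map_list_sum, List.map_map, Function.comp_def, LinearMap.lTensor_tmul,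
      counit_ofPath]
    rw [← sum_splittings_counit_right K p fun c q => ofPath K q ⊗ₜ[K] (1 : K)]
    simp only [← TensorProduct.tmul_smul, smul_eq_mul, mul_one]

end PathCoalgebra

/-- A subspace `D` of a coalgebra `C` is a subcoalgebra if `Δ(D) ⊆ D ⊗ D`. -/
def IsSubcoalgebra (K : Type*) [Field K] {C : Type*} [AddCommGroup C] [Module K C]
    [Coalgebra K C] (D : Submodule K C) : Prop :=
  ∀ x ∈ D, Coalgebra.comul (R := K) x ∈ LinearMap.range (TensorProduct.map D.subtype D.subtype)

/-- A simple subcoalgebra: a nonzero subcoalgebra whose only subcoalgebras are `0` and itself. -/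
def IsSimpleSubcoalgebra (K : Type*) [Field K] {C : Type*} [AddCommGroup C] [Module K C]
    [Coalgebra K C] (D : Submodule K C) : Prop :=
  IsSubcoalgebra K D ∧ D ≠ ⊥ ∧
    ∀ E : Submodule K C, IsSubcoalgebra K E → E ≤ D → E = ⊥ ∨ E = D

open Classical in
/-- A coalgebra is cosemisimple if it is a direct sum of simple subcoalgebras. -/
def IsCosemisimple (K : Type*) [Field K] (C : Type*) [AddCommGroup C] [Module K C]
    [Coalgebra K C] : Prop :=
  ∃ S : Set (Submodule K C), (∀ D ∈ S, IsSimpleSubcoalgebra K D) ∧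
    DirectSum.IsInternal (fun D : S => (D : Submodule K C))

/-- The coalgebra `C` has a Hopf algebra structure: up to isomorphism of coalgebras, `C` is the
underlying coalgebra of a Hopf algebra. (Along such an isomorphism, multiplication, unit and
antipode are carried over to `C` itself.) -/
def HasHopfAlgebraStructure.{u, v} (K : Type u) [Field K] (C : Type v) [AddCommGroup C]
    [Module K C] [Coalgebra K C] : Prop :=
  ∃ (H : Type v) (_ : Ring H) (_ : HopfAlgebra K H), Nonempty (C ≃ₗc[K] H)

/-! Both equivalences go through the absence of arrows. The group-like elements of `KΓ` are the
vertices, and an arrow `e : a ⟶ b` is skew-primitive: `Δ e = a ⊗ e + e ⊗ b`. In a Hopf structure the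
vertices are invertible. Left multiplication by `g = b a⁻¹` turns `e` into a skew-primitive element
from `b` to `c = g b`, outside the span of the vertices because `g` is invertible; this forces an
arrow `b ⟶ c` (`exists_hom_of_hopfAlgebra`). Iteration gives paths of every length, against finite
dimension. A nonzero subcoalgebra contains a vertex (`exists_ofPath_nil_mem`), so simple
subcoalgebras are lines spanned by vertices, and their sum misses every arrow. Without arrows, `KΓ`
is the direct sum of these lines, and any group law on the vertices makes it a group algebra. -/

namespace PathCoalgebra

variable {K : Type*} [Field K] {V : Type*} [Quiver V]

/-! ### Coefficients of the comultiplication -/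

/-- The coefficient of the path `P` in an element of `KΓ`. -/
noncomputable def coeff (K : Type*) [Field K] {V : Type*} [Quiver V] (P : AllPaths V) :
    PathCoalgebra K V →ₗ[K] K :=
  (pathBasis K V).coord P

/-- The coefficient of `P ⊗ Q` in an element of `KΓ ⊗ KΓ`. -/
noncomputable def coeffTensor (K : Type*) [Field K] {V : Type*} [Quiver V] (P Q : AllPaths V) :
    PathCoalgebra K V ⊗[K] PathCoalgebra K V →ₗ[K] K :=
  LinearMap.mul' K K ∘ₗ TensorProduct.map (coeff K P) (coeff K Q)

@[simp]
theorem coeffTensor_tmul (P Q : AllPaths V) (x y : PathCoalgebra K V) :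
    coeffTensor K P Q (x ⊗ₜ[K] y) = coeff K P x * coeff K Q y := rfl

open Classical in
theorem coeff_ofPath {a b : V} (p : Quiver.Path a b) (Q : AllPaths V) :
    coeff K Q (ofPath K p) = if (⟨a, b, p⟩ : AllPaths V) = Q then 1 else 0 := by
  simp [coeff, ofPath, Finsupp.single_apply]

@[simp]
theorem coeff_ofPath_self {a b : V} (p : Quiver.Path a b) :
    coeff K ⟨a, b, p⟩ (ofPath K p) = 1 := by
  simp [coeff_ofPath]

theorem ext_coeff {x y : PathCoalgebra K V} (h : ∀ P, coeff K P x = coeff K P y) : x = y :=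
  (pathBasis K V).ext_elem h

/-- Dually, coordinate functionals multiply by concatenation: the pair `(q, r)` occurs exactly once
among the splittings of `q.comp r` and in those of no other path. -/
theorem coeffTensor_comul_comp {a b c : V} (q : Quiver.Path a c) (r : Quiver.Path c b)
    (x : PathCoalgebra K V) :
    coeffTensor K ⟨a, c, q⟩ ⟨c, b, r⟩ (Coalgebra.comul (R := K) x) =
      coeff K ⟨a, b, q.comp r⟩ x := by
  classical
  suffices h : coeffTensor K ⟨a, c, q⟩ ⟨c, b, r⟩ ∘ₗ Coalgebra.comul (R := K) =
      coeff K ⟨a, b, q.comp r⟩ from LinearMap.congr_fun h x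
  refine (pathBasis K V).ext ?_
  rintro ⟨a', b', p⟩
  change coeffTensor K _ _ (Coalgebra.comul (R := K) (ofPath K p)) = coeff K _ (ofPath K p)
  rw [comul_ofPath, map_list_sum, List.map_map]
  by_cases h : a' = a ∧ b' = b
  · obtain ⟨rfl, rfl⟩ := h
    have key : ∀ s : Splitting a' b',
        (coeffTensor K ⟨a', c, q⟩ ⟨c, b', r⟩ ∘ fun s : Splitting a' b' =>
          ofPath K s.2.1 ⊗ₜ[K] ofPath K s.2.2) s = if s = ⟨c, q, r⟩ then 1 else 0 := by
      rintro ⟨c', q', r'⟩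
      simp only [Function.comp_apply, coeffTensor_tmul, coeff_ofPath]
      by_cases hc : c' = c
      · subst hc
        by_cases hq : q' = q <;> simp [hq]
      · simp [hc]
    rw [List.map_congr_left fun s _ => key s, ← List.sum_toFinset _ (nodup_splittings p),
      Finset.sum_ite_eq', coeff_ofPath]
    simp [mem_splittings_iff, eq_comm]
  · rw [coeff_ofPath, if_neg (fun h' => h (by cases h'; exact ⟨rfl, rfl⟩))]
    refine List.sum_eq_zero fun z hz => ?_
    obtain ⟨⟨c', q', r'⟩, -, rfl⟩ := List.mem_map.1 hz
    simp only [Function.comp_apply, coeffTensor_tmul, coeff_ofPath]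
    by_cases ha : a' = a
    · rw [if_neg (c := (⟨c', b', r'⟩ : AllPaths V) = _)
        (fun h' => h ⟨ha, congrArg (fun P : AllPaths V => P.2.1) h'⟩), mul_zero]
    · simp [ha]

theorem coeffTensor_comul_of_ne {P Q : AllPaths V} (h : P.2.1 ≠ Q.1) (x : PathCoalgebra K V) :
    coeffTensor K P Q (Coalgebra.comul (R := K) x) = 0 := by
  classical
  suffices h : coeffTensor K P Q ∘ₗ Coalgebra.comul (R := K) = 0 from LinearMap.congr_fun h x
  refine (pathBasis K V).ext ?_
  rintro ⟨a', b', p⟩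
  change coeffTensor K _ _ (Coalgebra.comul (R := K) (ofPath K p)) = 0
  rw [comul_ofPath, map_list_sum, List.map_map]
  refine List.sum_eq_zero fun z hz => ?_
  obtain ⟨⟨c', q', r'⟩, -, rfl⟩ := List.mem_map.1 hz
  simp only [Function.comp_apply, coeffTensor_tmul, coeff_ofPath, mul_ite, mul_one, mul_zero]
  split_ifs with h₁ h₂
  · subst h₁ h₂
    exact absurd rfl h
  all_goals rfl

theorem exists_coeff_ne_zero_of_max_length {x : PathCoalgebra K V} (hx : x ≠ 0) :
    ∃ P : AllPaths V, coeff K P x ≠ 0 ∧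
      ∀ Q : AllPaths V, coeff K Q x ≠ 0 → Q.2.2.length ≤ P.2.2.length := by
  have hne : ((pathBasis K V).repr x).support.Nonempty := by
    rw [Finsupp.support_nonempty_iff]
    simpa using hx
  obtain ⟨P, hP, hmax⟩ := Finset.exists_max_image _ (fun P : AllPaths V => P.2.2.length) hne
  exact ⟨P, Finsupp.mem_support_iff.1 hP, fun Q hQ => hmax Q (Finsupp.mem_support_iff.2 hQ)⟩

/-! ### Group-like and skew-primitive elements -/

theorem isGroupLikeElem_ofPath_nil (v : V) :
    IsGroupLikeElem K (ofPath K (Quiver.Path.nil : Quiver.Path v v)) where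
  counit_eq_one := (counit_ofPath K _).trans (by simp)
  comul_eq_tmul_self := (comul_ofPath K _).trans (by simp [splittings])

theorem comul_ofPath_toPath {a b : V} (e : a ⟶ b) :
    Coalgebra.comul (R := K) (ofPath K e.toPath) =
      ofPath K (Quiver.Path.nil : Quiver.Path a a) ⊗ₜ[K] ofPath K e.toPath +
      ofPath K e.toPath ⊗ₜ[K] ofPath K (Quiver.Path.nil : Quiver.Path b b) :=
  (comul_ofPath K _).trans (by simp [splittings, Quiver.Hom.toPath])

/-- The group-like elements of `KΓ` are the vertices. -/
theorem _root_.IsGroupLikeElem.exists_eq_ofPath_nil {g : PathCoalgebra K V}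
    (hg : IsGroupLikeElem K g) :
    ∃ v : V, g = ofPath K (Quiver.Path.nil : Quiver.Path v v) := by
  classical
  obtain ⟨⟨a, b, p⟩, hP, hmax⟩ := exists_coeff_ne_zero_of_max_length hg.ne_zero
  have hmul (P Q : AllPaths V) : coeffTensor K P Q (Coalgebra.comul (R := K) g) =
      coeff K P g * coeff K Q g := by
    rw [hg.comul_eq_tmul_self, coeffTensor_tmul]
  have hcomp {P Q : AllPaths V} (hP : coeff K P g ≠ 0) (hQ : coeff K Q g ≠ 0) : P.2.1 = Q.1 := by
    by_contra h
    exact mul_ne_zero hP hQ (by rw [← hmul, coeffTensor_comul_of_ne h])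
  obtain rfl : b = a := hcomp hP hP
  -- The square of the loop `p` also has nonzero coefficient, so maximality gives `2 * p.length ≤
  -- p.length`.
  have hp : p.length = 0 := by
    have h := hmax ⟨b, b, p.comp p⟩ (by
      rw [← coeffTensor_comul_comp, hmul]
      exact mul_ne_zero hP hP)
    simpa using h
  obtain rfl := Quiver.Path.eq_nil_of_length_zero p hp
  have hQ {Q : AllPaths V} (hQ : coeff K Q g ≠ 0) : (⟨b, b, .nil⟩ : AllPaths V) = Q := by
    obtain ⟨c, d, q⟩ := Q
    obtain rfl : b = c := hcomp hP hQ
    obtain rfl : d = b := hcomp hQ hP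
    have h := hmax _ hQ
    obtain rfl := Quiver.Path.eq_nil_of_length_zero q (by simpa using h)
    rfl
  refine ⟨b, ext_coeff fun Q => ?_⟩
  rw [coeff_ofPath]
  split_ifs with h
  · subst h
    -- The remaining coefficient is a nonzero idempotent of `K`, hence `1`.
    have h := hmul ⟨b, b, .nil⟩ ⟨b, b, .nil⟩
    rw [coeffTensor_comul_comp, Quiver.Path.comp_nil] at h
    exact (mul_eq_left₀ hP).1 h.symm
  · by_contra h'
    exact h (hQ h')

/-- A skew-primitive element involving a path of positive length witnesses an arrow. -/
theorem nonempty_hom_of_comul_eq {v w : V} {x : PathCoalgebra K V}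
    (hx : Coalgebra.comul (R := K) x =
      ofPath K (Quiver.Path.nil : Quiver.Path v v) ⊗ₜ[K] x +
      x ⊗ₜ[K] ofPath K (Quiver.Path.nil : Quiver.Path w w))
    {P : AllPaths V} (hP : coeff K P x ≠ 0) (hlen : P.2.2.length ≠ 0) : Nonempty (v ⟶ w) := by
  classical
  obtain ⟨a, b, p⟩ := P
  cases p with
  | nil => exact absurd rfl hlen
  | @cons c _ p e =>
    -- Splitting off the last arrow forces the rest `p` to be the trivial path at `v`; splitting off
    -- the trivial end path (`h₂`) then forces `e` to end at `w`.
    have h₁ := coeffTensor_comul_comp p e.toPath x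
    rw [hx, map_add, coeffTensor_tmul, coeffTensor_tmul, coeff_ofPath, coeff_ofPath,
      if_neg (c := (⟨w, w, .nil⟩ : AllPaths V) = _)
        (fun h => by simpa using congrArg (fun P : AllPaths V => P.2.2.length) h),
      mul_zero, add_zero] at h₁
    have hv : (⟨v, v, .nil⟩ : AllPaths V) = ⟨a, c, p⟩ := by
      by_contra h
      rw [if_neg h, zero_mul] at h₁
      exact hP h₁.symm
    cases hv
    have h₂ := coeffTensor_comul_comp (Quiver.Path.nil.cons e) (Quiver.Path.nil : Quiver.Path b b) x
    rw [hx, map_add, coeffTensor_tmul, coeffTensor_tmul, coeff_ofPath, coeff_ofPath,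
      if_neg (c := (⟨v, v, .nil⟩ : AllPaths V) = _)
        (fun h => by simpa using congrArg (fun P : AllPaths V => P.2.2.length) h),
      zero_mul, zero_add] at h₂
    have hw : (⟨w, w, .nil⟩ : AllPaths V) = ⟨b, b, .nil⟩ := by
      by_contra h
      rw [if_neg h, mul_zero] at h₂
      exact hP h₂.symm
    cases hw
    exact ⟨e⟩

theorem mem_span_isGroupLikeElem {x : PathCoalgebra K V}
    (hx : ∀ P : AllPaths V, coeff K P x ≠ 0 → P.2.2.length = 0) :
    x ∈ Submodule.span K {g : PathCoalgebra K V | IsGroupLikeElem K g} := by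
  refine Submodule.span_mono ?_ ((pathBasis K V).mem_span_repr_support x)
  rintro _ ⟨⟨a, b, p⟩, hP, rfl⟩
  have hlen := hx _ (Finsupp.mem_support_iff.1 hP)
  cases p with
  | nil => exact isGroupLikeElem_ofPath_nil a
  | cons p e => simp at hlen

theorem coeff_eq_zero_of_mem_span_isGroupLikeElem {x : PathCoalgebra K V}
    (hx : x ∈ Submodule.span K {g : PathCoalgebra K V | IsGroupLikeElem K g}) {P : AllPaths V}
    (hP : P.2.2.length ≠ 0) : coeff K P x = 0 := by
  classical
  refine (Submodule.span_le (p := LinearMap.ker (coeff K P))).2 ?_ hx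
  intro g hg
  obtain ⟨v, rfl⟩ := IsGroupLikeElem.exists_eq_ofPath_nil hg
  rw [SetLike.mem_coe, LinearMap.mem_ker, coeff_ofPath, if_neg]
  rintro rfl
  exact hP rfl

/-! ### Hopf structures exclude arrows -/

/-- If `KΓ` carries a Hopf algebra structure, then every arrow can be continued. -/
theorem exists_hom_of_hopfAlgebra {H : Type*} [Ring H] [HopfAlgebra K H]
    (f : PathCoalgebra K V ≃ₗc[K] H) {a b : V} (e : a ⟶ b) : ∃ c : V, Nonempty (b ⟶ c) := by
  have hga := (isGroupLikeElem_ofPath_nil (K := K) a).map f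
  have hgb := (isGroupLikeElem_ofPath_nil (K := K) b).map f
  set A := f (ofPath K (Quiver.Path.nil : Quiver.Path a a))
  set B := f (ofPath K (Quiver.Path.nil : Quiver.Path b b)) with hB
  have hg : IsGroupLikeElem K (B * HopfAlgebra.antipode K A) := hgb.mul hga.antipode
  have hgA : B * HopfAlgebra.antipode K A * A = B := by
    rw [mul_assoc, hga.antipode_mul_cancel, mul_one]
  set g := B * HopfAlgebra.antipode K A
  obtain ⟨c, hc⟩ := ((hg.mul hgb).map f.symm).exists_eq_ofPath_nil
  refine ⟨c, ?_⟩
  have hx : Coalgebra.comul (R := K) (f.symm (g * f (ofPath K e.toPath))) =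
      ofPath K (Quiver.Path.nil : Quiver.Path b b) ⊗ₜ[K] f.symm (g * f (ofPath K e.toPath)) +
      f.symm (g * f (ofPath K e.toPath)) ⊗ₜ[K] ofPath K (Quiver.Path.nil : Quiver.Path c c) := by
    have hb : f.symm B = ofPath K (Quiver.Path.nil : Quiver.Path b b) := f.symm_apply_apply _
    rw [← hc, ← hb, ← CoalgHomClass.map_comp_comul_apply, Bialgebra.comul_mul,
      hg.comul_eq_tmul_self, ← CoalgHomClass.map_comp_comul_apply f, comul_ofPath_toPath,
      map_add, mul_add, map_add]
    simp only [TensorProduct.map_tmul, Algebra.TensorProduct.tmul_mul_tmul, LinearMap.coe_coe]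
    rw [hgA]
  by_contra hne
  have hmem := mem_span_isGroupLikeElem (x := f.symm (g * f (ofPath K e.toPath))) fun P hP => by
    by_contra hlen
    exact hne (nonempty_hom_of_comul_eq hx hP hlen)
  -- `F` undoes the translation by `g` and preserves the span of the group-likes, so it would put
  -- the arrow `e` itself in that span.
  let F : PathCoalgebra K V →ₗ[K] PathCoalgebra K V :=
    (f.symm : H →ₗ[K] PathCoalgebra K V) ∘ₗ
      LinearMap.mulLeft K (HopfAlgebra.antipode K g) ∘ₗ (f : PathCoalgebra K V →ₗ[K] H)
  have hF (y : PathCoalgebra K V) : F y = f.symm (HopfAlgebra.antipode K g * f y) := rfl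
  have hFx : F (f.symm (g * f (ofPath K e.toPath))) = ofPath K e.toPath := by
    rw [hF, f.apply_symm_apply, ← mul_assoc, hg.antipode_mul_cancel, one_mul, f.symm_apply_apply]
  have hmem' : F (f.symm (g * f (ofPath K e.toPath))) ∈
      Submodule.span K {g : PathCoalgebra K V | IsGroupLikeElem K g} := by
    refine (Submodule.span_le (p := Submodule.comap F (Submodule.span K _))).2 ?_ hmem
    exact fun h hh => Submodule.subset_span ((hg.antipode.mul (IsGroupLikeElem.map f hh)).map f.symm)
  rw [hFx] at hmem'
  have h := coeff_eq_zero_of_mem_span_isGroupLikeElem hmem' (P := ⟨a, b, e.toPath⟩) (by simp)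
  simp at h

theorem isEmpty_hom_of_hasHopfAlgebraStructure [FiniteDimensional K (PathCoalgebra K V)]
    (h : HasHopfAlgebraStructure K (PathCoalgebra K V)) (u v : V) : IsEmpty (u ⟶ v) := by
  obtain ⟨H, _, _, ⟨f⟩⟩ := h
  refine ⟨fun e => ?_⟩
  -- The induction carries an arrow leaving the endpoint, so that the path can always be extended.
  have hpath (n : ℕ) : ∃ (a b : V) (p : Quiver.Path u a) (_ : a ⟶ b), p.length = n := by
    induction n with
    | zero => exact ⟨u, v, .nil, e, rfl⟩
    | succ n ih =>
      obtain ⟨a, b, p, e', hp⟩ := ih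
      obtain ⟨c, ⟨e''⟩⟩ := exists_hom_of_hopfAlgebra f e'
      exact ⟨b, c, p.cons e', e'', by simp [hp]⟩
  have : Infinite (AllPaths V) := by
    refine Infinite.of_surjective (fun P : AllPaths V => P.2.2.length) fun n => ?_
    obtain ⟨a, -, p, -, hp⟩ := hpath n
    exact ⟨⟨u, a, p⟩, hp⟩
  have := Module.Finite.finite_basis (pathBasis K V)
  exact not_finite (AllPaths V)

/-! ### Simple subcoalgebras and cosemisimplicity -/

/-- Contraction of the second tensor factor with the coefficient of the path `P`. -/
noncomputable def contractRight (K : Type*) [Field K] {V : Type*} [Quiver V] (P : AllPaths V) :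
    PathCoalgebra K V ⊗[K] PathCoalgebra K V →ₗ[K] PathCoalgebra K V :=
  (TensorProduct.rid K _).toLinearMap ∘ₗ LinearMap.lTensor _ (coeff K P)

theorem contractRight_tmul (P : AllPaths V) (x y : PathCoalgebra K V) :
    contractRight K P (x ⊗ₜ[K] y) = coeff K P y • x := rfl

theorem coeff_contractRight (P Q : AllPaths V)
    (t : PathCoalgebra K V ⊗[K] PathCoalgebra K V) :
    coeff K Q (contractRight K P t) = coeffTensor K Q P t := by
  induction t with
  | zero => simp
  | tmul x y => simp [contractRight_tmul, mul_comm]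
  | add s t hs ht => simp [hs, ht]

theorem contractRight_comul_mem {D : Submodule K (PathCoalgebra K V)} (hD : IsSubcoalgebra K D)
    (P : AllPaths V) {x : PathCoalgebra K V} (hx : x ∈ D) :
    contractRight K P (Coalgebra.comul (R := K) x) ∈ D := by
  obtain ⟨t, ht⟩ := hD x hx
  rw [← ht]
  clear ht
  induction t with
  | zero => simp
  | tmul y z =>
    rw [TensorProduct.map_tmul, contractRight_tmul]
    exact D.smul_mem _ y.2
  | add s t hs ht => simpa using D.add_mem hs ht

/-- A nonzero subcoalgebra of `KΓ` contains a vertex. -/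
theorem exists_ofPath_nil_mem {D : Submodule K (PathCoalgebra K V)} (hD : IsSubcoalgebra K D)
    (hne : D ≠ ⊥) : ∃ v : V, ofPath K (Quiver.Path.nil : Quiver.Path v v) ∈ D := by
  classical
  obtain ⟨x, hx, hx0⟩ := D.ne_bot_iff.1 hne
  obtain ⟨⟨a, b, p⟩, hP, hmax⟩ := exists_coeff_ne_zero_of_max_length hx0
  refine ⟨a, ?_⟩
  have h := contractRight_comul_mem hD ⟨a, b, p⟩ hx
  -- The coefficient of `q` in the contraction is that of `q.comp p` in `x`, which vanishes for `q`
  -- of positive length because `p` is longest.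
  have heq : contractRight K ⟨a, b, p⟩ (Coalgebra.comul (R := K) x) =
      coeff K ⟨a, b, p⟩ x • ofPath K (Quiver.Path.nil : Quiver.Path a a) := by
    refine ext_coeff ?_
    rintro ⟨c, d, q⟩
    rw [coeff_contractRight, map_smul, coeff_ofPath, smul_eq_mul]
    split_ifs with hq
    · cases hq
      rw [coeffTensor_comul_comp, Quiver.Path.nil_comp, mul_one]
    · rw [mul_zero]
      by_cases hd : d = a
      · subst hd
        rw [coeffTensor_comul_comp]
        by_contra h0
        have hlen := hmax _ h0
        cases q with
        | nil => exact hq rfl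
        | cons q e =>
          simp only [Quiver.Path.length_comp, Quiver.Path.length_cons] at hlen
          omega
      · exact coeffTensor_comul_of_ne hd x
  rw [heq] at h
  exact (D.smul_mem_iff hP).1 h

theorem isSimpleSubcoalgebra_span_ofPath_nil (v : V) :
    IsSimpleSubcoalgebra K
      (Submodule.span K {ofPath K (Quiver.Path.nil : Quiver.Path v v)}) := by
  have hv := isGroupLikeElem_ofPath_nil (K := K) v
  refine ⟨fun x hx => ?_, by simpa using hv.ne_zero, fun E _ hE =>
    (nonzero_span_atom _ hv.ne_zero).le_iff.1 hE⟩
  obtain ⟨c, rfl⟩ := Submodule.mem_span_singleton.1 hx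
  refine ⟨c • (⟨_, Submodule.mem_span_singleton_self _⟩ ⊗ₜ[K]
    ⟨_, Submodule.mem_span_singleton_self _⟩), ?_⟩
  rw [map_smul, map_smul, hv.comul_eq_tmul_self]
  rfl

theorem _root_.IsSimpleSubcoalgebra.exists_eq_span_ofPath_nil
    {D : Submodule K (PathCoalgebra K V)} (hD : IsSimpleSubcoalgebra K D) :
    ∃ v : V, D = Submodule.span K {ofPath K (Quiver.Path.nil : Quiver.Path v v)} := by
  obtain ⟨v, hv⟩ := exists_ofPath_nil_mem hD.1 hD.2.1
  have h := isSimpleSubcoalgebra_span_ofPath_nil (K := K) v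
  refine ⟨v, ((hD.2.2 _ h.1 ?_).resolve_left h.2.1).symm⟩
  simpa [Submodule.span_le] using hv

theorem isEmpty_hom_of_isCosemisimple (h : IsCosemisimple K (PathCoalgebra K V)) (u v : V) :
    IsEmpty (u ⟶ v) := by
  obtain ⟨S, hS, hint⟩ := h
  refine ⟨fun e => ?_⟩
  have htop : ⨆ D : S, (D : Submodule K (PathCoalgebra K V)) ≤
      Submodule.span K {g : PathCoalgebra K V | IsGroupLikeElem K g} := by
    refine iSup_le fun D => ?_
    obtain ⟨w, hw⟩ := (hS D D.2).exists_eq_span_ofPath_nil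
    rw [hw]
    exact Submodule.span_mono (by simpa using isGroupLikeElem_ofPath_nil w)
  rw [hint.submodule_iSup_eq_top] at htop
  have h := coeff_eq_zero_of_mem_span_isGroupLikeElem (K := K)
    (htop (Submodule.mem_top (x := ofPath K e.toPath))) (P := ⟨u, v, e.toPath⟩) (by simp)
  simp at h

/-! ### Quivers without arrows -/

theorem pathBasis_eq_ofPath_nil (h : ∀ u v : V, IsEmpty (u ⟶ v)) (P : AllPaths V) :
    pathBasis K V P = ofPath K (Quiver.Path.nil : Quiver.Path P.1 P.1) := by
  obtain ⟨a, b, p⟩ := P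
  cases p with
  | nil => rfl
  | cons p e => exact (h _ _).elim e

theorem isCosemisimple_of_isEmpty_hom (h : ∀ u v : V, IsEmpty (u ⟶ v)) :
    IsCosemisimple K (PathCoalgebra K V) := by
  refine ⟨Set.range fun P : AllPaths V => Submodule.span K {pathBasis K V P}, ?_, ?_⟩
  · rintro _ ⟨P, rfl⟩
    simp only [pathBasis_eq_ofPath_nil h]
    exact isSimpleSubcoalgebra_span_ofPath_nil _
  · refine DirectSum.isInternal_submodule_of_iSupIndep_of_iSup_eq_top ?_ ?_
    · exact (sSupIndep_iff _).1
        (pathBasis K V).linearIndependent.iSupIndep_span_singleton.sSupIndep_range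
    · rw [← sSup_eq_iSup', sSup_range, ← Submodule.span_range_eq_iSup, (pathBasis K V).span_eq]

theorem hasHopfAlgebraStructure_of_isEmpty_hom [Nonempty V]
    [FiniteDimensional K (PathCoalgebra K V)] (h : ∀ u v : V, IsEmpty (u ⟶ v)) :
    HasHopfAlgebraStructure K (PathCoalgebra K V) := by
  have : Finite (AllPaths V) := Module.Finite.finite_basis (pathBasis K V)
  have : Nonempty (AllPaths V) := ‹Nonempty V›.map fun v => ⟨v, v, .nil⟩
  have : NeZero (Nat.card (AllPaths V)) := ⟨Nat.card_pos.ne'⟩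
  -- Any group law would do, as every basis element is group-like; the cyclic one exists on every
  -- nonempty finite set.
  let φ : AllPaths V ≃ Multiplicative (ZMod (Nat.card (AllPaths V))) :=
    (Finite.equivFin _).trans ((ZMod.finEquiv _).toEquiv.trans Multiplicative.ofAdd)
  let _ : Group (AllPaths V) := φ.group
  let f : PathCoalgebra K V ≃ₗ[K] MonoidAlgebra K (AllPaths V) :=
    (pathBasis K V).equiv (MonoidAlgebra.basis (AllPaths V) K) (Equiv.refl _)
  have hf (P : AllPaths V) : f (pathBasis K V P) = MonoidAlgebra.single P 1 := by
    simp [f, MonoidAlgebra.basis_apply]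
  have hg (P : AllPaths V) : IsGroupLikeElem K (pathBasis K V P) := by
    rw [pathBasis_eq_ofPath_nil h]
    exact isGroupLikeElem_ofPath_nil _
  refine ⟨MonoidAlgebra K (AllPaths V), inferInstance, inferInstance, ⟨{ f with
    counit_comp := (pathBasis K V).ext fun P => ?_
    map_comp_comul := (pathBasis K V).ext fun P => ?_ }⟩⟩
  · change Coalgebra.counit (R := K) (f (pathBasis K V P)) =
      Coalgebra.counit (R := K) (pathBasis K V P)
    rw [hf, (hg P).counit_eq_one]
    simp
  · change TensorProduct.map f.toLinearMap f.toLinearMap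
        (Coalgebra.comul (R := K) (pathBasis K V P)) =
      Coalgebra.comul (R := K) (f (pathBasis K V P))
    rw [(hg P).comul_eq_tmul_self, hf]
    simp [hf]

end PathCoalgebra

theorem mainTheorem10 {K : Type*} [Field K] {V : Type*} [Quiver V] [Nonempty V]
    (hfin : FiniteDimensional K (PathCoalgebra K V)) :
    (HasHopfAlgebraStructure K (PathCoalgebra K V) ↔ IsCosemisimple K (PathCoalgebra K V)) ∧
      (IsCosemisimple K (PathCoalgebra K V) ↔ ∀ u v : V, IsEmpty (u ⟶ v)) :=
  ⟨⟨fun h => PathCoalgebra.isCosemisimple_of_isEmpty_hom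
      (PathCoalgebra.isEmpty_hom_of_hasHopfAlgebraStructure h),
    fun h => PathCoalgebra.hasHopfAlgebraStructure_of_isEmpty_hom
      (PathCoalgebra.isEmpty_hom_of_isCosemisimple h)⟩,
    PathCoalgebra.isEmpty_hom_of_isCosemisimple, PathCoalgebra.isCosemisimple_of_isEmpty_hom⟩
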